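/- A (real) communication protocol for inputs $(x,y)\in\mathbb R^{n_1+n_2}$ is a finite rooted tree. Each inner vertex $v$ carries a polynomial that is either an $a_v\in\mathbb R[X_1,\dots,X_{n_1}]$ (calculated by the first party) or a $b_v\in\mathbb R[Y_1,\dots,Y_{n_2}]$ (calculated by the second party). If $q_1,\dots,q_r$ are the polynomials attached to the vertices on the path from the root to $v$ (both included), then $v$ also carries finitely many testing polynomials $P_{v,1},\dots,P_{v,N_v}\in\mathbb R[Q_1,\dots,Q_r]$, of arbitrary degrees, and the computation branches at $v$ according to the vector of signs ($<$, $=$ or $>$) of the values $P_{v,j}(q_1(x,y),\dots,q_r(x,y))$, $1\le j\le N_v$. Each leaf is labelled "accept" or "reject", and the label of the leaf reached by $(x,y)$ is the output. The depth of the protocol is the maximal number of inner vertices on a path from the root to a leaf. A probabilistic communication protocol is a finite family $C=\{C_i\}_i$ of communication protocols, where $C_i$ is chosen with probability $p_i\ge 0$, $\sum_i p_i=1$. It recognizes a set $S\subset\mathbb R^{n_1+n_2}$ if for every input $(x,y)\in\mathbb R^{n_1+n_2}$ the output is correct ("accept" if $(x,y)\in S$, "reject" if $(x,y)\notin S$)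 with probability greater than $2/3$. Its depth is the maximal depth of the $C_i$, and the probabilistic communication complexity of $S$ is the least depth of a probabilistic communication protocol that recognizes $S$. The dimension of a semialgebraic set $A\subset\mathbb R^N$ is the Krull dimension of $\mathbb R[Z_1,\dots,Z_N]/I(A)$, where $I(A)$ is the ideal of the polynomials that vanish on $A$. **Corollary.** Let $n\ge 0$ be an integer, let $U=\{(x,y)\in\mathbb R^{2n}: x_1y_1+\cdots+x_ny_n=0\}$, let $S\subset\mathbb R^{2n}$ be a semialgebraic set, and let $\partial(S)$ be its boundary in the Euclidean topology. If $\dim(\partial(S)\cap U)=2n-1$, then the probabilistic communication complexity of $S$ is greater than or equal to $n-3$. -/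

import Mathlib

namespace RealComm

/-- Points of `ℝ^(n₁+n₂)`: the coordinates are split into a group `x` of size `n₁` (the first
party's variables) and a group `y` of size `n₂` (the second party's variables). -/
abbrev Point (n₁ n₂ : ℕ) : Type := Fin n₁ ⊕ Fin n₂ → ℝ

/-- Semialgebraic subsets of a real affine space: the Boolean algebra of sets generated by the
polynomial conditions `p = 0` and `p > 0`. -/
inductive IsSemialgebraic {σ : Type} : Set (σ → ℝ) → Prop
  | eqZero (p : MvPolynomial σ ℝ) : IsSemialgebraic {z | MvPolynomial.eval z p = 0}
  | pos (p : MvPolynomial σ ℝ) : IsSemialgebraic {z | 0 < MvPolynomial.eval z p}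
  | union {A B : Set (σ → ℝ)} :
      IsSemialgebraic A → IsSemialgebraic B → IsSemialgebraic (A ∪ B)
  | inter {A B : Set (σ → ℝ)} :
      IsSemialgebraic A → IsSemialgebraic B → IsSemialgebraic (A ∩ B)
  | compl {A : Set (σ → ℝ)} : IsSemialgebraic A → IsSemialgebraic Aᶜ

/-- The dimension of a semialgebraic set `A` (Bochnak, Coste, Roy): the Krull dimension of the
ring of polynomial functions on `A`, that is of `ℝ[z] / I(A)`, where `I(A)` is the ideal of all
polynomials vanishing on `A`. The empty set has dimension `⊥`. -/
noncomputable def semialgDim {σ : Type} (A : Set (σ → ℝ)) : WithBot ℕ∞ :=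
  ringKrullDim (MvPolynomial σ ℝ ⧸ MvPolynomial.vanishingIdeal ℝ A)

/-- Communication protocols over the reals, as rooted trees. `Protocol n₁ n₂ r` is the type of
subtrees hanging at a vertex before which `r` polynomials have been calculated on the path from
the root; whole protocols are the terms of `Protocol n₁ n₂ 0`.

An inner vertex carries either a polynomial `a` in the variables `x` (calculated by the first
party) or a polynomial `b` in the variables `y` (calculated by the second party), together with
`N` testing polynomials `P` in all the `r + 1` values calculated so far, the value calculated at
this vertex included. It has one child for every vector of `N` signs. A leaf carries the label
"accept" (`true`) or "reject" (`false`). -/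
inductive Protocol (n₁ n₂ : ℕ) : ℕ → Type
  | leaf {r : ℕ} (label : Bool) : Protocol n₁ n₂ r
  | first {r : ℕ} (a : MvPolynomial (Fin n₁) ℝ) (N : ℕ)
      (P : Fin N → MvPolynomial (Fin (r + 1)) ℝ)
      (child : (Fin N → SignType) → Protocol n₁ n₂ (r + 1)) : Protocol n₁ n₂ r
  | second {r : ℕ} (b : MvPolynomial (Fin n₂) ℝ) (N : ℕ)
      (P : Fin N → MvPolynomial (Fin (r + 1)) ℝ)
      (child : (Fin N → SignType) → Protocol n₁ n₂ (r + 1)) : Protocol n₁ n₂ r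

namespace Protocol

variable {n₁ n₂ : ℕ}

/-- The depth of a protocol: the maximal number of inner vertices (hence of polynomials
calculated by the two parties together) on a path from the root to a leaf. -/
def depth : {r : ℕ} → Protocol n₁ n₂ r → ℕ
  | _, leaf _ => 0
  | _, first _ _ _ child => (Finset.univ.sup fun s => (child s).depth) + 1
  | _, second _ _ _ child => (Finset.univ.sup fun s => (child s).depth) + 1

/-- The label of the leaf reached by the input `z = (x, y)`, when `q` lists the values that have
been calculated so far. -/
noncomputable def output (z : Point n₁ n₂) :
    {r : ℕ} → Protocol n₁ n₂ r → (q : Fin r → ℝ) → Bool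
  | _, leaf label, _ => label
  | r, first a _ P child, q =>
      let q' : Fin (r + 1) → ℝ :=
        Fin.snoc q (MvPolynomial.eval (fun i => z (Sum.inl i)) a)
      (child fun j => SignType.sign (MvPolynomial.eval q' (P j))).output z q'
  | r, second b _ P child, q =>
      let q' : Fin (r + 1) → ℝ :=
        Fin.snoc q (MvPolynomial.eval (fun i => z (Sum.inr i)) b)
      (child fun j => SignType.sign (MvPolynomial.eval q' (P j))).output z q'

/-- The protocol outputs "accept" on the input `z`. -/
def Accepts (C : Protocol n₁ n₂ 0) (z : Point n₁ n₂) : Prop :=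
  C.output z Fin.elim0 = true

end Protocol

/-- A probabilistic communication protocol: a finite family of communication protocols, the
`i`-th of which is chosen with probability `prob i`. -/
structure ProbProtocol (n₁ n₂ : ℕ) where
  size : ℕ
  member : Fin size → Protocol n₁ n₂ 0
  prob : Fin size → ℝ
  prob_nonneg : ∀ i, 0 ≤ prob i
  prob_sum : ∑ i, prob i = 1

namespace ProbProtocol

variable {n₁ n₂ : ℕ}

/-- The maximal depth of the protocols that constitute the family. -/
def depth (C : ProbProtocol n₁ n₂) : ℕ :=
  Finset.univ.sup fun i => (C.member i).depth

open Classical in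
/-- The probability that the output on the input `z` is the correct one for membership in `S`. -/
noncomputable def correctProb (C : ProbProtocol n₁ n₂) (S : Set (Point n₁ n₂))
    (z : Point n₁ n₂) : ℝ :=
  ∑ i, if ((C.member i).Accepts z ↔ z ∈ S) then C.prob i else 0

/-- `C` recognizes `S`: on every input the output is correct with probability greater
than `2/3`. -/
def Recognizes (C : ProbProtocol n₁ n₂) (S : Set (Point n₁ n₂)) : Prop :=
  ∀ z, 2 / 3 < C.correctProb S z

end ProbProtocol

/-- The probabilistic communication complexity of recognizing `S`: the least depth of a
probabilistic communication protocol that recognizes `S` (and `⊤` if there is none). -/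
noncomputable def probCommComplexity {n₁ n₂ : ℕ} (S : Set (Point n₁ n₂)) : ℕ∞ :=
  ⨅ (C : ProbProtocol n₁ n₂) (_ : C.Recognizes S), (C.depth : ℕ∞)

/-- The quadric `U = {x₁ y₁ + ⋯ + xₙ yₙ = 0}` in `ℝ^(2n)`. -/
def quadric (n : ℕ) : Set (Point n n) :=
  {z | ∑ i : Fin n, z (Sum.inl i) * z (Sum.inr i) = 0}

end RealComm

namespace RealComm

open MvPolynomial Filter Topology

/-! Let `g = ∑ xᵢ yᵢ`. The point is that `g` divides no nonzero polynomial `f` in `r < n - 1`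
one-sided polynomials (`not_pairing_dvd_aeval`). Linear algebra gives a nonzero derivation `D = ∑
uᵢ(x) ∂/∂xᵢ` that kills all of them, hence `f`. If `g ∣ f`, then `g ∣ D g = ∑ uᵢ(x) yᵢ`, which
`not_pairing_dvd` excludes. Hence the tests of a protocol of depth below `n - 1` have constant sign
near a generic point of the quadric, and so has its output. As `∂S ∩ U` has codimension one in the
space, it contains a point generic for all members at once. Near it lie points of `S` and of its
complement with identical outputs, and these cannot both be answered correctly with probability
above `2/3`. -/

/-- The quadratic form `x₁ y₁ + ⋯ + xₙ yₙ`. -/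
noncomputable def pairing (n : ℕ) : MvPolynomial (Fin n ⊕ Fin n) ℝ :=
  ∑ i, X (Sum.inl i) * X (Sum.inr i)

/-- A polynomial in one of the two groups of variables only. -/
def OneSided {n₁ n₂ : ℕ} (q : MvPolynomial (Fin n₁ ⊕ Fin n₂) ℝ) : Prop :=
  (∃ a, q = rename Sum.inl a) ∨ ∃ b, q = rename Sum.inr b

theorem mem_quadric_iff {n : ℕ} (z : Point n n) : z ∈ quadric n ↔ eval z (pairing n) = 0 := by
  simp [quadric, pairing]

/-- For `n = 1` the form is the product `xy`; two terms are needed for irreducibility. -/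
theorem prime_pairing {n : ℕ} (hn : 2 ≤ n) : Prime (pairing n) := by
  have h : pairing n = sumSMulXSMulY (Finsupp.equivFunOnFinite.symm fun _ : Fin n => (1 : ℝ)) := by
    simp [pairing, sumSMulXSMulY, Finsupp.linearCombination_apply, Finsupp.sum_fintype]
  rw [h]
  refine (irreducible_sumSMulXSMulY _ ?_ fun r hr => ?_).prime
  · exact ⟨⟨0, by omega⟩, by simp, ⟨1, by omega⟩, by simp, by simp⟩
  · exact isUnit_of_dvd_one (by simpa using hr ⟨0, by omega⟩)

/-! ### Derivations in the first group of variables -/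

/-- The derivation `∑ uᵢ(x) ∂/∂xᵢ` of `ℝ[x, y]`. -/
noncomputable def xDerivation {n₁ : ℕ} (n₂ : ℕ) (u : Fin n₁ → MvPolynomial (Fin n₁) ℝ) :
    Derivation ℝ (MvPolynomial (Fin n₁ ⊕ Fin n₂) ℝ) (MvPolynomial (Fin n₁ ⊕ Fin n₂) ℝ) :=
  mkDerivation ℝ (Sum.elim (fun i => rename Sum.inl (u i)) 0)

theorem xDerivation_rename_inl {n₁ n₂ : ℕ} (u : Fin n₁ → MvPolynomial (Fin n₁) ℝ)
    (a : MvPolynomial (Fin n₁) ℝ) :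
    xDerivation n₂ u (rename Sum.inl a) = rename Sum.inl (∑ i, pderiv i a * u i) := by
  induction a using MvPolynomial.induction_on with
  | C r => simp
  | add p q hp hq => simp [hp, hq, add_mul, Finset.sum_add_distrib]
  | mul_X p i hp =>
    have h : xDerivation n₂ u (X (Sum.inl i)) = rename Sum.inl (u i) := by
      simp [xDerivation, mkDerivation_X]
    simp only [map_mul, rename_X, Derivation.leibniz, hp, h, smul_eq_mul, add_mul,
      Finset.sum_add_distrib, pderiv_X, map_add, map_sum]
    simp [Pi.single_apply, Finset.mul_sum, mul_assoc, apply_ite, Finset.sum_ite_eq]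

theorem xDerivation_rename_inr {n₁ n₂ : ℕ} (u : Fin n₁ → MvPolynomial (Fin n₁) ℝ)
    (b : MvPolynomial (Fin n₂) ℝ) :
    xDerivation n₂ u (rename Sum.inr b) = 0 := by
  induction b using MvPolynomial.induction_on with
  | C r => simp
  | add p q hp hq => simp [hp, hq]
  | mul_X p i hp =>
    have h : xDerivation n₂ u (X (Sum.inr i)) = 0 := by simp [xDerivation, mkDerivation_X]
    simp [hp, h]

theorem xDerivation_pairing {n : ℕ} (u : Fin n → MvPolynomial (Fin n) ℝ) :
    xDerivation n u (pairing n) = ∑ i, rename Sum.inl (u i) * X (Sum.inr i) := by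
  simp [pairing, xDerivation, mkDerivation_X, mul_comm]

/-- Fewer than `n - 1` one-sided polynomials are annihilated by a nonzero derivation
`∑ uᵢ(x) ∂/∂xᵢ` with a prescribed zero coefficient. -/
theorem exists_xDerivation_eq_zero {n₁ n₂ r : ℕ} (hr : r + 1 < n₁) (i₀ : Fin n₁)
    (q : Fin r → MvPolynomial (Fin n₁ ⊕ Fin n₂) ℝ) (hq : ∀ j, OneSided (q j)) :
    ∃ u : Fin n₁ → MvPolynomial (Fin n₁) ℝ,
      u ≠ 0 ∧ u i₀ = 0 ∧ ∀ j, xDerivation n₂ u (q j) = 0 := by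
  have ha : ∀ j, ∃ a : MvPolynomial (Fin n₁) ℝ, ∀ u : Fin n₁ → MvPolynomial (Fin n₁) ℝ,
      ∑ i, pderiv i a * u i = 0 → xDerivation n₂ u (q j) = 0 := by
    intro j
    obtain ⟨a, h⟩ | ⟨b, h⟩ := hq j
    · exact ⟨a, fun u hu => by rw [h, xDerivation_rename_inl, hu, map_zero]⟩
    -- Every such derivation kills polynomials in `y`, so these impose no condition on `u`.
    · exact ⟨0, fun u _ => by rw [h, xDerivation_rename_inr]⟩
  choose a ha using ha
  -- The `r` conditions on `u` and `u i₀ = 0` are `r + 1 < n₁` linear equations in `n₁` unknowns.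
  let L : (Fin n₁ → MvPolynomial (Fin n₁) ℝ) →ₗ[MvPolynomial (Fin n₁) ℝ]
      (Fin (r + 1) → MvPolynomial (Fin n₁) ℝ) :=
    LinearMap.pi (Fin.snoc
      (α := fun _ => (Fin n₁ → MvPolynomial (Fin n₁) ℝ) →ₗ[MvPolynomial (Fin n₁) ℝ] _)
      (fun j => ∑ i, pderiv i (a j) • LinearMap.proj i) (LinearMap.proj i₀))
  have hL : ¬ Function.Injective L := fun h => by
    have := le_of_fin_injective _ L h
    omega
  rw [← LinearMap.ker_eq_bot, Submodule.eq_bot_iff] at hL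
  push Not at hL
  obtain ⟨u, hu, hu0⟩ := hL
  rw [LinearMap.mem_ker] at hu
  refine ⟨u, hu0, ?_, fun j => ha j u ?_⟩
  · simpa [L] using congrFun hu (Fin.last r)
  · simpa [L] using congrFun hu j.castSucc

/-- A linear form `∑ uᵢ(x) yᵢ` with `u ≠ 0` and one zero coefficient is not divisible by
`∑ xᵢ yᵢ`. -/
theorem not_pairing_dvd {n : ℕ} (u : Fin n → MvPolynomial (Fin n) ℝ) (hu : u ≠ 0) (i₀ : Fin n)
    (hi₀ : u i₀ = 0) :
    ¬ pairing n ∣ ∑ i, rename Sum.inl (u i) * X (Sum.inr i) := by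
  rintro ⟨k, hk⟩
  obtain ⟨j, hj⟩ := Function.ne_iff.mp hu
  -- The factor `X i₀` makes `x i₀ ≠ 0`, which the definition of `c` divides by.
  have hne : u j * X i₀ ≠ 0 := mul_ne_zero hj (X_ne_zero _)
  obtain ⟨x, hx⟩ : ∃ x, eval x (u j * X i₀) ≠ 0 := by
    by_contra! h
    exact hne (MvPolynomial.funext fun x => by simpa using h x)
  simp only [map_mul, eval_X, mul_ne_zero_iff] at hx
  -- With `y = w - c eᵢ₀`, the constant `c` puts `(x, y)` on the quadric. Since `u i₀ = 0`, the
  -- correction does not affect `∑ uᵢ(x) yᵢ`, which equals `∑ wᵢ²`; this sum of real squares must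
  -- then vanish.
  let w : Fin n → ℝ := fun i => eval x (u i)
  let c : ℝ := (∑ i, x i * w i) / x i₀
  let z : Point n n := Sum.elim x (w - Pi.single i₀ c)
  have h := congrArg (eval z) hk
  have hz : eval z (pairing n) = 0 := by
    simp only [pairing, map_sum, map_mul, eval_X, z, Sum.elim_inl, Sum.elim_inr, Pi.sub_apply,
      mul_sub, Finset.sum_sub_distrib, Pi.single_apply, mul_ite, mul_zero, Finset.sum_ite_eq',
      Finset.mem_univ, if_true, c]
    field_simp [hx.2]
    simp
  have hw : ∑ i, w i * w i = 0 := by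
    have hcomp : z ∘ Sum.inl = x := rfl
    have hw0 : w i₀ = 0 := by simp [w, hi₀]
    have : ∑ i, w i * (w i - (Pi.single i₀ c : Fin n → ℝ) i) = 0 := by
      simpa [map_mul, hz, eval_rename, hcomp, z] using h
    simpa [mul_sub, Finset.sum_sub_distrib, Pi.single_apply, hw0] using this
  rw [Finset.sum_eq_zero_iff_of_nonneg fun i _ => mul_self_nonneg _] at hw
  exact hx.1 (mul_self_eq_zero.mp (hw j (Finset.mem_univ _)))

/-- A derivation that annihilates a nonzero multiple of a prime maps the prime to one of its
multiples. -/
theorem prime_dvd_derivation {A : Type*} [CommRing A] [IsDomain A] [WfDvdMonoid A] [Algebra ℝ A]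
    (D : Derivation ℝ A A) {g f : A} (hg : Prime g) (hf : f ≠ 0) (hgf : g ∣ f) (hD : D f = 0) :
    g ∣ D g := by
  obtain ⟨m, h, hh, rfl⟩ := WfDvdMonoid.max_power_factor hf hg.irreducible
  obtain _ | m := m
  · exact absurd (by simpa using hgf) hh
  -- Leibniz rule for `f = g ^ (m + 1) * h` with `g ∤ h`; characteristic zero then makes `m + 1` a
  -- unit.
  have key : g ^ m * (g * D h + (m + 1) * (D g * h)) = 0 := by
    rw [← hD]
    simp only [Derivation.leibniz, Derivation.leibniz_pow, smul_eq_mul, nsmul_eq_mul]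
    push_cast
    ring
  have key' := (mul_eq_zero.mp key).resolve_left (pow_ne_zero _ hg.ne_zero)
  have hdvd : g ∣ ((m : A) + 1) * (D g * h) :=
    ⟨-D h, by linear_combination key'⟩
  have hunit : IsUnit ((m : A) + 1) := by
    have : ((m : A) + 1) = algebraMap ℝ A (m + 1) := by simp
    rw [this]
    exact (IsUnit.mk0 _ (by positivity)).map _
  exact (hg.dvd_or_dvd ((hunit.dvd_mul_left).mp hdvd)).resolve_right hh

/-- A nonzero polynomial in fewer than `n - 1` one-sided polynomials is not divisible by
`∑ xᵢ yᵢ`. -/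
theorem not_pairing_dvd_aeval {n r : ℕ} (hr : r + 1 < n)
    (q : Fin r → MvPolynomial (Fin n ⊕ Fin n) ℝ) (hq : ∀ j, OneSided (q j))
    (P : MvPolynomial (Fin r) ℝ) (hP : aeval q P ≠ 0) : ¬ pairing n ∣ aeval q P := by
  intro hdvd
  obtain ⟨u, hu, hi₀, hD⟩ := exists_xDerivation_eq_zero hr ⟨0, by omega⟩ q hq
  have hDP : ∀ Q : MvPolynomial (Fin r) ℝ, xDerivation n u (aeval q Q) = 0 := fun Q => by
    induction Q using MvPolynomial.induction_on with
    | C c => rw [aeval_C, Derivation.map_algebraMap]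
    | add Q₁ Q₂ h₁ h₂ => rw [map_add, map_add, h₁, h₂, add_zero]
    | mul_X Q i h => rw [map_mul, aeval_X, Derivation.leibniz, h, hD, smul_zero, smul_zero, add_zero]
  refine not_pairing_dvd u hu _ hi₀ ?_
  rw [← xDerivation_pairing]
  exact prime_dvd_derivation _ (prime_pairing (by omega)) hP hdvd (hDP P)

/-! ### Local constancy of outputs -/

/-- Off the zero set of a polynomial, its sign is locally constant. -/
theorem eventually_sign_eval_eq {σ : Type*} [Finite σ] (f : MvPolynomial σ ℝ) (z₀ : σ → ℝ)
    (h : f = 0 ∨ eval z₀ f ≠ 0) :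
    ∀ᶠ z in 𝓝 z₀, SignType.sign (eval z f) = SignType.sign (eval z₀ f) := by
  obtain rfl | h := h
  · simp
  have hc : Tendsto (fun z => eval z f) (𝓝 z₀) (𝓝 (eval z₀ f)) :=
    (MvPolynomial.continuous_eval f).tendsto z₀
  obtain h | h := lt_or_gt_of_ne h
  · filter_upwards [hc.eventually_lt_const h] with z hz
    rw [sign_neg hz, sign_neg h]
  · filter_upwards [hc.eventually_const_lt h] with z hz
    rw [sign_pos hz, sign_pos h]

/-- The inductive step for vertices of protocols, for both parties at once. -/
theorem exists_forall_eventually_step {n N r : ℕ} (hr : r + 1 < n)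
    (q : Fin r → MvPolynomial (Fin n ⊕ Fin n) ℝ) (hq : ∀ j, OneSided (q j))
    (P : Fin N → MvPolynomial (Fin r) ℝ) (out : (Fin N → SignType) → Point n n → Bool)
    (hout : ∀ s, ∃ F, ¬ pairing n ∣ F ∧ ∀ z₀, eval z₀ F ≠ 0 →
      ∀ᶠ z in 𝓝 z₀, out s z = out s z₀) :
    ∃ F, ¬ pairing n ∣ F ∧ ∀ z₀, eval z₀ F ≠ 0 → ∀ᶠ z in 𝓝 z₀,
      out (fun j => SignType.sign (eval (fun i => eval z (q i)) (P j))) z =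
      out (fun j => SignType.sign (eval (fun i => eval z₀ (q i)) (P j))) z₀ := by
  classical
  have hp := prime_pairing (n := n) (by omega)
  choose F hF hFout using hout
  let f : Fin N → MvPolynomial (Fin n ⊕ Fin n) ℝ := fun j => aeval q (P j)
  -- A test that vanishes identically has constant sign, so it is replaced by `1` to keep the
  -- product below nonzero modulo `g`.
  let f' : Fin N → MvPolynomial (Fin n ⊕ Fin n) ℝ := fun j => if f j = 0 then 1 else f j
  have hf : ∀ z j, eval (fun i => eval z (q i)) (P j) = eval z (f j) := fun z j => by
    simp only [f, ← coe_aeval_eq_eval, RingHom.coe_coe]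
    exact (comp_aeval_apply (f := q) (aeval z) (P j)).symm
  refine ⟨(∏ s, F s) * ∏ j, f' j, ?_, fun z₀ hz₀ => ?_⟩
  · rw [hp.dvd_mul, hp.dvd_finsetProd_iff, hp.dvd_finsetProd_iff]
    rintro (⟨s, -, hs⟩ | ⟨j, -, hj⟩)
    · exact hF s hs
    · by_cases h0 : f j = 0
      · exact hp.not_dvd_one (by simpa [f', h0] using hj)
      · exact not_pairing_dvd_aeval hr q hq (P j) h0 (by simpa only [f', h0, if_false] using hj)
  · simp only [map_mul, map_prod, mul_ne_zero_iff, Finset.prod_ne_zero_iff, Finset.mem_univ,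
      true_imp_iff] at hz₀
    have hsign : ∀ᶠ z in 𝓝 z₀, ∀ j,
        SignType.sign (eval z (f j)) = SignType.sign (eval z₀ (f j)) := by
      refine eventually_all.mpr fun j => eventually_sign_eval_eq _ _ ?_
      by_cases h0 : f j = 0
      · exact Or.inl h0
      · exact Or.inr (by simpa [f', h0] using hz₀.2 j)
    simp only [hf]
    filter_upwards [hsign, hFout _ z₀ (hz₀.1 fun j => SignType.sign (eval z₀ (f j)))] with z h1 h2
    rw [funext h1, h2]

/-- The output of a protocol of small depth is locally constant off the zero set of a polynomial
that does not vanish identically on the quadric. -/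
theorem exists_forall_eventually_output_eq {n r : ℕ} (C : Protocol n n r)
    (q : Fin r → MvPolynomial (Fin n ⊕ Fin n) ℝ) (hq : ∀ j, OneSided (q j)) (hn : 2 ≤ n)
    (hC : r + C.depth + 1 < n) :
    ∃ F, ¬ pairing n ∣ F ∧ ∀ z₀, eval z₀ F ≠ 0 → ∀ᶠ z in 𝓝 z₀,
      C.output z (fun i => eval z (q i)) = C.output z₀ (fun i => eval z₀ (q i)) := by
  have hsnoc : ∀ {r : ℕ} (q : Fin r → MvPolynomial (Fin n ⊕ Fin n) ℝ)
      (a : MvPolynomial (Fin n ⊕ Fin n) ℝ) (z : Point n n),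
      (Fin.snoc (α := fun _ => ℝ) (fun i => eval z (q i)) (eval z a)) =
      fun i => eval z (Fin.snoc (α := fun _ => MvPolynomial (Fin n ⊕ Fin n) ℝ) q a i) := by
    intro r q a z
    ext i
    refine Fin.lastCases ?_ (fun i => ?_) i <;> simp
  have hside : ∀ {r : ℕ} (q : Fin r → MvPolynomial (Fin n ⊕ Fin n) ℝ)
      (a : MvPolynomial (Fin n ⊕ Fin n) ℝ), (∀ j, OneSided (q j)) → OneSided a → ∀ j,
      OneSided (Fin.snoc (α := fun _ => MvPolynomial (Fin n ⊕ Fin n) ℝ) q a j) := by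
    intro r q a hq ha j
    refine Fin.lastCases (by simpa) (fun i => by simpa using hq i) j
  induction C with
  | leaf label => exact ⟨1, (prime_pairing hn).not_dvd_one, fun z₀ _ => by simp [Protocol.output]⟩
  | @first r a N P child ih =>
    have ha : OneSided (n₁ := n) (n₂ := n) (rename Sum.inl a) := Or.inl ⟨a, rfl⟩
    have heval : ∀ z : Point n n, eval (fun i => z (Sum.inl i)) a = eval z (rename Sum.inl a) :=
      fun z => (eval_rename _ _ _).symm
    simp only [Protocol.depth] at hC
    simp only [Protocol.output, heval, hsnoc]
    refine exists_forall_eventually_step (by omega) _ (hside q _ hq ha) P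
      (fun s z => (child s).output z _) fun s => ih s _ (hside q _ hq ha) ?_
    have := Finset.le_sup (f := fun s => (child s).depth) (Finset.mem_univ s)
    omega
  | @second r a N P child ih =>
    have ha : OneSided (n₁ := n) (n₂ := n) (rename Sum.inr a) := Or.inr ⟨a, rfl⟩
    have heval : ∀ z : Point n n, eval (fun i => z (Sum.inr i)) a = eval z (rename Sum.inr a) :=
      fun z => (eval_rename _ _ _).symm
    simp only [Protocol.depth] at hC
    simp only [Protocol.output, heval, hsnoc]
    refine exists_forall_eventually_step (by omega) _ (hside q _ hq ha) P
      (fun s z => (child s).output z _) fun s => ih s _ (hside q _ hq ha) ?_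
    have := Finset.le_sup (f := fun s => (child s).depth) (Finset.mem_univ s)
    omega

/-! ### Codimension one and the probabilistic bound -/

/-- A polynomial that vanishes on a subset of the quadric of codimension one is a multiple of the
equation of the quadric. -/
theorem pairing_dvd_of_semialgDim {n : ℕ} (hn : 2 ≤ n) (A : Set (Point n n)) (hA : A ⊆ quadric n)
    (hdim : semialgDim A + 1 = ((2 * n : ℕ) : WithBot ℕ∞)) (F : MvPolynomial (Fin n ⊕ Fin n) ℝ)
    (hF : ∀ z ∈ A, eval z F = 0) : pairing n ∣ F := by
  by_contra hdvd
  have hp := prime_pairing hn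
  have : (Ideal.span {pairing n}).IsPrime := (Ideal.span_singleton_prime hp.ne_zero).mpr hp
  have hle : Ideal.span {pairing n} ≤ vanishingIdeal ℝ A := by
    rw [Ideal.span_singleton_le_iff_mem, mem_vanishingIdeal_iff]
    exact fun z hz => by simpa [aeval_eq_eval] using (mem_quadric_iff z).mp (hA hz)
  -- If `g ∤ F`, then `F` is a nonzero element of the domain `ℝ[x, y] / (g)` that dies in `ℝ[x, y] /
  -- I(A)`, so the dimension drops by one. It drops once more from `ℝ[x, y]` to `ℝ[x, y] / (g)`,
  -- which is one drop too many.
  have h1 : semialgDim A + 1 ≤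
      ringKrullDim (MvPolynomial (Fin n ⊕ Fin n) ℝ ⧸ Ideal.span {pairing n}) := by
    refine ringKrullDim_succ_le_of_surjective (Ideal.Quotient.factor hle)
      (Ideal.Quotient.factor_surjective hle) (r := Ideal.Quotient.mk _ F) ?_ ?_
    · rw [mem_nonZeroDivisors_iff_ne_zero, Ne, Ideal.Quotient.eq_zero_iff_mem,
        Ideal.mem_span_singleton]
      exact hdvd
    · rw [Ideal.Quotient.factor_mk, Ideal.Quotient.eq_zero_iff_mem, mem_vanishingIdeal_iff]
      exact fun z hz => by simpa [aeval_eq_eval] using hF z hz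
  have h2 := ringKrullDim_quotient_succ_le_of_nonZeroDivisor
    (mem_nonZeroDivisors_of_ne_zero hp.ne_zero)
  rw [MvPolynomial.ringKrullDim_of_isNoetherianRing, ringKrullDim_eq_zero_of_field] at h2
  rw [hdim] at h1
  have h3 : ((2 * n : ℕ) : WithBot ℕ∞) + 1 ≤ ((2 * n : ℕ) : WithBot ℕ∞) := by
    refine (add_le_add_left h1 1).trans (h2.trans ?_)
    simp [two_mul]
  have h4 : 2 * n + 1 ≤ 2 * n := by exact_mod_cast h3
  omega

/-- A protocol whose members all give the same output on a member and on a non-member of `S` does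
not recognize `S`. -/
theorem ProbProtocol.not_recognizes {n₁ n₂ : ℕ} (C : ProbProtocol n₁ n₂) (S : Set (Point n₁ n₂))
    {z w : Point n₁ n₂} (hz : z ∈ S) (hw : w ∉ S)
    (h : ∀ i, (C.member i).Accepts z ↔ (C.member i).Accepts w) : ¬ C.Recognizes S := by
  classical
  intro hC
  -- Each member is correct at exactly one of `z` and `w`.
  have hsum : C.correctProb S z + C.correctProb S w = 1 := by
    rw [← C.prob_sum, ProbProtocol.correctProb, ProbProtocol.correctProb,
      ← Finset.sum_add_distrib]
    refine Finset.sum_congr rfl fun i _ => ?_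
    by_cases hi : (C.member i).Accepts w <;> simp [hz, hw, h, hi]
  have h1 := hC z
  have h2 := hC w
  linarith

/-- A probabilistic protocol that recognizes a set whose boundary contains a part of codimension
one of the quadric has depth at least `n - 1`. -/
theorem ProbProtocol.le_depth {n : ℕ} (hn : 2 ≤ n) (S : Set (Point n n))
    (hdim : semialgDim (frontier S ∩ quadric n) + 1 = ((2 * n : ℕ) : WithBot ℕ∞))
    (C : ProbProtocol n n) (hC : C.Recognizes S) : n ≤ C.depth + 1 := by
  by_contra! hlt
  have hp := prime_pairing hn
  have hdepth : ∀ i, (C.member i).depth ≤ C.depth := fun i =>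
    Finset.le_sup (f := fun i => (C.member i).depth) (Finset.mem_univ i)
  choose F hF hFout using fun i => exists_forall_eventually_output_eq (C.member i) Fin.elim0
    (fun j => j.elim0) hn (by have := hdepth i; omega)
  have hprod : ¬ pairing n ∣ ∏ i, F i := by
    rw [hp.dvd_finsetProd_iff]
    rintro ⟨i, -, hi⟩
    exact hF i hi
  obtain ⟨z₀, hz₀, hne⟩ : ∃ z ∈ frontier S ∩ quadric n, eval z (∏ i, F i) ≠ 0 := by
    by_contra! h
    exact hprod (pairing_dvd_of_semialgDim hn _ Set.inter_subset_right hdim _ h)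
  simp only [map_prod, Finset.prod_ne_zero_iff, Finset.mem_univ, true_imp_iff] at hne
  have hev : ∀ᶠ z in 𝓝 z₀, ∀ i, (C.member i).Accepts z ↔ (C.member i).Accepts z₀ := by
    refine eventually_all.mpr fun i => ?_
    filter_upwards [hFout i z₀ (hne i)] with z hz
    rw [Subsingleton.elim (fun i => eval z (Fin.elim0 i)) Fin.elim0,
      Subsingleton.elim (fun i => eval z₀ (Fin.elim0 i)) Fin.elim0] at hz
    rw [Protocol.Accepts, Protocol.Accepts, hz]
  have hfr := hz₀.1
  rw [frontier_eq_closure_inter_closure, Set.mem_inter_iff, mem_closure_iff_frequently,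
    mem_closure_iff_frequently] at hfr
  obtain ⟨z, hzS, hz⟩ := (hfr.1.and_eventually hev).exists
  obtain ⟨w, hwS, hw⟩ := (hfr.2.and_eventually hev).exists
  exact C.not_recognizes S hzS hwS (fun i => (hz i).trans (hw i).symm) hC

end RealComm

theorem mainTheorem5 (n : ℕ) (S : Set (RealComm.Point n n))
    (hS : RealComm.IsSemialgebraic S)
    (hdim : RealComm.semialgDim (frontier S ∩ RealComm.quadric n) + 1
      = ((2 * n : ℕ) : WithBot ℕ∞)) :
    (n : ℕ∞) - 3 ≤ RealComm.probCommComplexity S := by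
  refine le_iInf₂ fun C hC => tsub_le_iff_right.mpr ?_
  -- For `n < 2` the truncated difference is `0`; otherwise the stronger bound `n - 1` holds.
  obtain hn | hn := lt_or_ge n 2
  · exact le_add_left (by exact_mod_cast (by omega : n ≤ 3))
  · have h := RealComm.ProbProtocol.le_depth hn S hdim C hC
    exact_mod_cast (by omega : n ≤ C.depth + 3)
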